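/- Let $N\ge 1$, $0<T<\infty$, let $1\le p_1\le\dots\le p_N$ be real numbers, $\mathbf p=(p_1,\dots,p_N)$, and let $$\bar p=\Big(\frac1N\sum_{i=1}^N\frac1{p_i}\Big)^{-1}.$$ Assume $\bar p<N$, set $\bar p^*=\frac{N\bar p}{N-\bar p}$, let $\sigma\in[1,\bar p^*]$, and define the critical parabolic exponent $\bar p_\sigma=\bar p\,(1+\frac{\sigma}{N})$. Let $L^{\mathbf p}(0,T;W^{1,\mathbf p}_{\rm loc}(\mathbb R^N))$ be the space of all $u\in L^1(0,T;L^1_{\rm loc}(\mathbb R^N))$ whose weak spatial derivatives satisfy $D_iu\in L^{p_i}(0,T;L^{p_i}_{\rm loc}(\mathbb R^N))$ for $i=1,\dots,N$; its topology is given by the seminorms $\|u\|_{L^1(K\times(0,T))}+\sum_{i}\|D_iu\|_{L^{p_i}(K\times(0,T))}$, $K\subset\mathbb R^N$ compact. Equip $L^q(0,T;L^q_{\rm loc}(\mathbb R^N))$ with the seminorms $\|u\|_{L^q(K\times(0,T))}$, $L^\infty(0,T;L^\sigma_{\rm loc}(\mathbb R^N))$ with the seminorms $\operatorname{ess\,sup}_{0<t<T}\|u(\cdot,t)\|_{L^\sigma(K)}$,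 and intersections with the sums of the seminorms. Then the embedding $$L^{p_N}(0,T;L^{p_N}_{\rm loc}(\mathbb R^N))\cap L^{\mathbf p}(0,T;W^{1,\mathbf p}_{\rm loc}(\mathbb R^N))\cap L^\infty(0,T;L^\sigma_{\rm loc}(\mathbb R^N))\hookrightarrow L^{\bar p_\sigma}(0,T;L^{\bar p_\sigma}_{\rm loc}(\mathbb R^N))$$ holds. Moreover, if $\bar p_\sigma>p_N$, then $$L^{\mathbf p}(0,T;W^{1,\mathbf p}_{\rm loc}(\mathbb R^N))\cap L^\infty(0,T;L^\sigma_{\rm loc}(\mathbb R^N))\hookrightarrow L^{\bar p_\sigma}(0,T;L^{\bar p_\sigma}_{\rm loc}(\mathbb R^N)).$$ Here $\hookrightarrow$ means inclusion together with continuity: for every compact $K$ there are a compact $K'$ and a constant $C$ such that for every $u$ in the space on the left, $\|u\|_{L^{\bar p_\sigma}(K\times(0,T))}$ is at most $C$ times the seminorm of $u$ over $K'$ of that space. -/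

import Mathlib

open MeasureTheory Set
open scoped ENNReal NNReal ContDiff

noncomputable section

namespace AnisoParabolic

/-- The harmonic mean `p̄ = ((1/N) ∑ 1/pᵢ)⁻¹` of the exponents. -/
def harmonicMean {N : ℕ} (p : Fin N → ℝ) : ℝ :=
  ((1 / (N : ℝ)) * ∑ i, 1 / p i)⁻¹

/-- The anisotropic Sobolev exponent `p̄* = N p̄ / (N - p̄)` (used for `p̄ < N`). -/
def sobolevExponent {N : ℕ} (p : Fin N → ℝ) : ℝ :=
  N * harmonicMean p / (N - harmonicMean p)

/-- The critical parabolic exponent `p̄_σ = p̄ (1 + σ / N)`. -/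
def criticalExponent {N : ℕ} (p : Fin N → ℝ) (σ : ℝ) : ℝ :=
  harmonicMean p * (1 + σ / N)

/-- `g` is the weak `i`-th partial derivative of `v` on `ℝ^N`. -/
def HasWeakPartialDeriv {N : ℕ} (i : Fin N) (v g : (Fin N → ℝ) → ℝ) : Prop :=
  LocallyIntegrable v ∧ LocallyIntegrable g ∧
    ∀ φ : (Fin N → ℝ) → ℝ, ContDiff ℝ ∞ φ → HasCompactSupport φ →
      ∫ x, v x * fderiv ℝ φ x (Pi.single i 1) = - ∫ x, g x * φ x

/-- `Du = (D₁u, …, D_N u)` is the weak spatial gradient of `u` on `ℝ^N × ]0, T[`: each `Dᵢu` is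
measurable on `ℝ^N × ]0, T[` and, for almost every time `t`, the function `Dᵢu(·, t)` is the weak
`i`-th partial derivative of `u(·, t)`. By Fubini's theorem, for `u` and `Dᵢu` integrable on
`K × ]0, T[` for all compact `K` (as in `LpW1Loc` below), this is the same as `Dᵢu` being the weak
derivative of `u` in the sense of distributions on `ℝ^N × ]0, T[`. -/
def IsSpatialGradient {N : ℕ} (T : ℝ) (u : (Fin N → ℝ) × ℝ → ℝ)
    (Du : Fin N → (Fin N → ℝ) × ℝ → ℝ) : Prop :=
  ∀ i, AEStronglyMeasurable (Du i) (volume.restrict (univ ×ˢ Ioo 0 T)) ∧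
    ∀ᵐ t ∂(volume.restrict (Ioo 0 T)),
      HasWeakPartialDeriv i (fun x => u (x, t)) (fun x => Du i (x, t))

/-- The norm of `u` in `L^q(0, T; L^q(K)) = L^q(K × ]0, T[)`. -/
def normLq {N : ℕ} (q T : ℝ) (K : Set (Fin N → ℝ)) (u : (Fin N → ℝ) × ℝ → ℝ) : ℝ≥0∞ :=
  eLpNorm u (ENNReal.ofReal q) (volume.restrict (K ×ˢ Ioo 0 T))

/-- The norm of `u` in `L^∞(0, T; L^σ(K))`. -/
def normLinftyL {N : ℕ} (σ T : ℝ) (K : Set (Fin N → ℝ)) (u : (Fin N → ℝ) × ℝ → ℝ) : ℝ≥0∞ :=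
  essSup (fun t => eLpNorm (fun x => u (x, t)) (ENNReal.ofReal σ) (volume.restrict K))
    (volume.restrict (Ioo 0 T))

/-- The space `L^q(0, T; L^q_loc(ℝ^N))`, with seminorms `normLq q T K`, `K` compact. -/
def LqLoc (N : ℕ) (q T : ℝ) : Set ((Fin N → ℝ) × ℝ → ℝ) :=
  {u | ∀ K : Set (Fin N → ℝ), IsCompact K →
    MemLp u (ENNReal.ofReal q) (volume.restrict (K ×ˢ Ioo 0 T))}

/-- The space `L^∞(0, T; L^σ_loc(ℝ^N))`, with seminorms `normLinftyL σ T K`, `K` compact. -/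
def LinftyLoc (N : ℕ) (σ T : ℝ) : Set ((Fin N → ℝ) × ℝ → ℝ) :=
  {u | AEStronglyMeasurable u (volume.restrict (univ ×ˢ Ioo 0 T)) ∧
    ∀ K : Set (Fin N → ℝ), IsCompact K → normLinftyL σ T K u < ⊤}

/-- The space `L^𝐩(0, T; W^{1,𝐩}_loc(ℝ^N))` of all `u ∈ L¹(0, T; L¹_loc)` whose weak spatial
derivatives satisfy `Dᵢu ∈ L^{pᵢ}(0, T; L^{pᵢ}_loc)`. -/
def LpW1Loc {N : ℕ} (p : Fin N → ℝ) (T : ℝ) : Set ((Fin N → ℝ) × ℝ → ℝ) :=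
  {u | u ∈ LqLoc N 1 T ∧
    ∃ Du : Fin N → (Fin N → ℝ) × ℝ → ℝ,
      IsSpatialGradient T u Du ∧ ∀ i, Du i ∈ LqLoc N (p i) T}

/-- The seminorms of `L^𝐩(0, T; W^{1,𝐩}_loc(ℝ^N))`, for a function `u` with spatial
gradient `Du`. -/
def normLpW1 {N : ℕ} (p : Fin N → ℝ) (T : ℝ) (K : Set (Fin N → ℝ))
    (u : (Fin N → ℝ) × ℝ → ℝ) (Du : Fin N → (Fin N → ℝ) × ℝ → ℝ) : ℝ≥0∞ :=
  normLq 1 T K u + ∑ i, normLq (p i) T K (Du i)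

end AnisoParabolic

end

/-! ### Gagliardo's inequality and one-dimensional estimates -/

namespace AnisoParabolic

/-! The core is Troisi's anisotropic Sobolev inequality. For `w` in `C¹` with compact support,
integrating along the `i`-th axis bounds `|w|^γᵢ` by a line integral of `γᵢ |w|^(γᵢ-1) |Dᵢw|`. With
`γᵢ = 1 + p̄*(1 - 1/pᵢ)` the product of these bounds, raised to `1/(N-1)`, has `|w|^p̄*` on the
left. Gagliardo's inequality and Hölder's then leave powers of `∫|w|^p̄*` and of `∫|Dᵢw|^pᵢ` on the
right; the former is absorbed because its exponent is below 1 when `p̄ < N`. Mollification and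
Fatou's lemma extend this to weak derivatives.

Since `p̄_σ = p̄*(1 - p̄/N) + σ p̄/N`, interpolating on each time slice bounds `∫|w|^p̄_σ` by a
product of `∫|Dᵢw|^pᵢ` to the powers `p̄/(N pᵢ)`, times a factor controlled by the `L^∞(L^σ)` norm.
Those powers sum to 1, so Hölder in time integrates the estimate exactly
(`exists_lintegral_criticalExponent_le`).

Applied to `η u` with a cutoff `η`, the gradient acquires the term `u Dᵢη`, which must be controlled
in `L^{pᵢ}`: this is the role of `L^{p_N}` in the first embedding. For the second, known `L^s`
control lets one run the same estimate with exponents `min pᵢ s`; the gain in summability is at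
least the factor `κ = p̄_σ/p_N > 1`, so finitely many steps starting from `L¹` reach `p_N`
(`LocalControl.criticalExponent_min`, `mul_le_criticalExponent_min`). -/

/-- The Gagliardo inequality with a different function along each coordinate direction, up to a
dimensional constant. -/
theorem lintegral_prod_lintegral_rpow_le {ι : Type*} [Fintype ι] [DecidableEq ι] {r : ℝ}
    (hr : Real.HolderConjugate (Fintype.card ι) r) {f : ι → (ι → ℝ) → ℝ≥0∞}
    (hf : ∀ i, Measurable (f i)) {B : ι → ℝ≥0∞} (hB0 : ∀ i, B i ≠ 0) (hBt : ∀ i, B i ≠ ⊤)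
    (hB : ∀ i, ∫⁻ x, f i x ≤ B i) :
    ∫⁻ x : ι → ℝ, ∏ i, (∫⁻ t, f i (Function.update x i t)) ^ ((1 : ℝ) / (Fintype.card ι - 1 : ℝ))
      ≤ (Fintype.card ι : ℝ≥0∞) ^ r *
        ∏ i, B i ^ ((1 : ℝ) / (Fintype.card ι - 1 : ℝ)) := by
  have h1 : (1 : ℝ) < Fintype.card ι := hr.lt
  set s : ℝ := (1 : ℝ) / (Fintype.card ι - 1 : ℝ) with hs
  have hs0 : 0 ≤ s := by rw [hs]; apply div_nonneg zero_le_one; linarith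
  -- Normalising each `f j` by `B j` reduces to Gagliardo's inequality for one function: `f i ≤ B i
  -- * F`, while `F` has integral at most the dimension.
  let F : (ι → ℝ) → ℝ≥0∞ := fun x => ∑ j, (B j)⁻¹ * f j x
  have hF : Measurable F :=
    Finset.measurable_sum _ fun j _ => (hf j).const_mul _
  have hfF : ∀ i x, f i x ≤ B i * F x := by
    intro i x
    calc f i x = B i * ((B i)⁻¹ * f i x) := by
          rw [← mul_assoc, ENNReal.mul_inv_cancel (hB0 i) (hBt i), one_mul]
      _ ≤ B i * F x := by
          gcongr
          exact Finset.single_le_sum (f := fun j => (B j)⁻¹ * f j x) (fun _ _ => zero_le)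
            (Finset.mem_univ i)
  have hFint : ∫⁻ x, F x ≤ Fintype.card ι := by
    rw [lintegral_finsetSum _ fun j _ => (hf j).const_mul _]
    calc ∑ j, ∫⁻ x, (B j)⁻¹ * f j x ≤ ∑ _j : ι, 1 := by
          refine Finset.sum_le_sum fun j _ => ?_
          rw [lintegral_const_mul _ (hf j), ← ENNReal.inv_mul_cancel (hB0 j) (hBt j)]
          gcongr
          exact hB j
      _ = Fintype.card ι := by simp
  calc ∫⁻ x : ι → ℝ, ∏ i, (∫⁻ t, f i (Function.update x i t)) ^ s
      ≤ ∫⁻ x : ι → ℝ, (∏ i, B i ^ s) * ∏ i, (∫⁻ t, F (Function.update x i t)) ^ s := by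
        refine lintegral_mono fun x => ?_
        dsimp only
        rw [← Finset.prod_mul_distrib]
        refine Finset.prod_le_prod' fun i _ => ?_
        rw [← ENNReal.mul_rpow_of_nonneg _ _ hs0]
        refine ENNReal.rpow_le_rpow ?_ hs0
        rw [← lintegral_const_mul' _ _ (hBt i)]
        exact lintegral_mono fun t => hfF i _
    _ = (∏ i, B i ^ s) * ∫⁻ x : ι → ℝ, ∏ i, (∫⁻ t, F (Function.update x i t)) ^ s := by
        refine lintegral_const_mul' _ _ ?_
        exact ENNReal.prod_ne_top fun i _ => ENNReal.rpow_ne_top_of_nonneg hs0 (hBt i)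
    _ ≤ (∏ i, B i ^ s) * (Fintype.card ι : ℝ≥0∞) ^ r := by
        gcongr
        refine (lintegral_prod_lintegral_pow_le (fun _ => volume) hr hF).trans ?_
        exact ENNReal.rpow_le_rpow hFint hr.symm.nonneg
    _ = _ := mul_comm _ _

/-- The fundamental theorem of calculus for `|f|^γ`, whose derivative has size `γ |f|^(γ-1) |f'|`.
The case `γ = 1` is separate, since `|f|` need not be `C¹`. -/
theorem enorm_rpow_le_lintegral_deriv {f : ℝ → ℝ} (hf : ContDiff ℝ 1 f)
    (hfc : HasCompactSupport f) {γ : ℝ} (hγ : 1 ≤ γ) (x : ℝ) :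
    ‖f x‖ₑ ^ γ ≤ ∫⁻ t, ENNReal.ofReal γ * (‖f t‖ₑ ^ (γ - 1) * ‖deriv f t‖ₑ) := by
  rcases hγ.eq_or_lt with rfl | hγ
  · simp only [ENNReal.rpow_one, ENNReal.ofReal_one, one_mul, sub_self, ENNReal.rpow_zero]
    exact (hfc.enorm_le_lintegral_Ici_deriv hf x).trans
      (lintegral_mono' Measure.restrict_le_self le_rfl)
  · have hγ0 : 0 < γ := by linarith
    have hg : ContDiff ℝ 1 fun t => ‖f t‖ ^ γ := hf.norm_rpow hγ
    have hgc : HasCompactSupport fun t => ‖f t‖ ^ γ := by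
      refine hfc.comp_left (g := fun y : ℝ => ‖y‖ ^ γ) ?_
      simp [hγ0.ne']
    have hd : ∀ t, deriv (fun t => ‖f t‖ ^ γ) t = γ * |f t| ^ (γ - 2) * f t * deriv f t := by
      intro t
      have := (hasDerivAt_abs_rpow (f t) hγ).comp t
        (hf.differentiable one_ne_zero t).hasDerivAt
      exact this.deriv
    have key := (hgc.enorm_le_lintegral_Ici_deriv hg x).trans
      (lintegral_mono' Measure.restrict_le_self le_rfl)
    have e : ∀ y : ℝ, ‖‖y‖ ^ γ‖ₑ = ‖y‖ₑ ^ γ := by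
      intro y
      rw [Real.enorm_rpow_of_nonneg (norm_nonneg y) hγ0.le, enorm_norm]
    rw [e] at key
    refine key.trans (lintegral_mono fun t => ?_)
    dsimp only
    rw [hd, enorm_mul, ← mul_assoc]
    gcongr
    rcases eq_or_ne (f t) 0 with h0 | h0
    · simp [h0]
    · have : ‖γ * |f t| ^ (γ - 2) * f t‖ = γ * |f t| ^ (γ - 1) := by
        rw [norm_mul, norm_mul, Real.norm_of_nonneg hγ0.le, Real.norm_of_nonneg (by positivity),
          Real.norm_eq_abs, mul_assoc]
        congr 1
        have hpos : 0 < |f t| := abs_pos.2 h0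
        nth_rewrite 2 [← Real.rpow_one |f t|]
        rw [← Real.rpow_add hpos]
        congr 1; ring
      rw [← ofReal_norm, this, ENNReal.ofReal_mul hγ0.le,
        ← ENNReal.ofReal_rpow_of_nonneg (abs_nonneg _) (by linarith), ← Real.norm_eq_abs,
        ofReal_norm]

theorem enorm_rpow_le_lintegral_update {ι : Type*} [Fintype ι] [DecidableEq ι] {w : (ι → ℝ) → ℝ}
    (hw : ContDiff ℝ 1 w) (hwc : HasCompactSupport w) {γ : ℝ} (hγ : 1 ≤ γ) (i : ι) (x : ι → ℝ) :
    ‖w x‖ₑ ^ γ ≤ ∫⁻ t, ENNReal.ofReal γ * (‖w (Function.update x i t)‖ₑ ^ (γ - 1) *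
      ‖fderiv ℝ w (Function.update x i t) (Pi.single i 1)‖ₑ) := by
  have h := enorm_rpow_le_lintegral_deriv (f := fun t => w (Function.update x i t))
    (hw.comp (contDiff_update 1 x i))
    (hwc.comp_isClosedEmbedding (isClosedEmbedding_update x i)) hγ (x i)
  rw [Function.update_eq_self] at h
  refine h.trans_eq (lintegral_congr fun t => ?_)
  have : deriv (fun t => w (Function.update x i t)) t =
      fderiv ℝ w (Function.update x i t) (Pi.single i 1) := by
    have := ((hw.differentiable one_ne_zero _).hasFDerivAt).comp_hasDerivAt t
      (hasDerivAt_update x i t)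
    exact this.deriv
  rw [this]

end AnisoParabolic

/-! ### Exponents and Troisi's inequality for smooth functions -/

namespace AnisoParabolic

theorem prod_rpow_eq_rpow_sum {ι : Type*} (s : Finset ι) (x : ℝ≥0∞) {a : ι → ℝ}
    (ha : ∀ i ∈ s, 0 ≤ a i) : ∏ i ∈ s, x ^ a i = x ^ ∑ i ∈ s, a i := by
  classical
  induction s using Finset.induction with
  | empty => simp
  | insert j s hj ih =>
    rw [Finset.prod_insert hj, Finset.sum_insert hj,
      ih fun i hi => ha i (Finset.mem_insert_of_mem hi), ENNReal.rpow_add_of_nonneg]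
    · exact ha j (Finset.mem_insert_self _ _)
    · exact Finset.sum_nonneg fun i hi => ha i (Finset.mem_insert_of_mem hi)

section Exponents

variable {N : ℕ} {p : Fin N → ℝ}

theorem sum_one_div_pos (hN : 0 < N) (hp : ∀ i, 1 ≤ p i) : 0 < ∑ i, 1 / p i := by
  have : Nonempty (Fin N) := ⟨⟨0, hN⟩⟩
  exact Finset.sum_pos (fun i _ => one_div_pos.2 (zero_lt_one.trans_le (hp i)))
    Finset.univ_nonempty

theorem harmonicMean_eq (p : Fin N → ℝ) : harmonicMean p = N / ∑ i, 1 / p i := by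
  rw [harmonicMean, mul_inv, one_div, inv_inv, div_eq_mul_inv]

theorem sum_one_div_eq (hN : 0 < N) (hp : ∀ i, 1 ≤ p i) :
    ∑ i, 1 / p i = N / harmonicMean p := by
  have := sum_one_div_pos hN hp
  have hN' : (0 : ℝ) < N := by exact_mod_cast hN
  rw [harmonicMean_eq]
  field_simp

theorem one_le_harmonicMean (hN : 0 < N) (hp : ∀ i, 1 ≤ p i) : 1 ≤ harmonicMean p := by
  have h := sum_one_div_pos hN hp
  rw [harmonicMean_eq, le_div_iff₀ h, one_mul]
  calc ∑ i, 1 / p i ≤ ∑ _i : Fin N, (1 : ℝ) := by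
        refine Finset.sum_le_sum fun i _ => ?_
        rw [div_le_one (zero_lt_one.trans_le (hp i))]
        exact hp i
    _ = N := by simp

theorem one_lt_dim (hN : 0 < N) (hp : ∀ i, 1 ≤ p i) (hP : harmonicMean p < N) :
    (1 : ℝ) < N :=
  (one_le_harmonicMean hN hp).trans_lt hP

end Exponents

theorem lintegral_rpow_mul_le_of_contDiff {N : ℕ} {w g : (Fin N → ℝ) → ℝ}
    (hw : Continuous w) (hg : Continuous g) {p q : ℝ} (hp : 1 ≤ p) :
    ∫⁻ x, ‖w x‖ₑ ^ (q * (1 - 1 / p)) * ‖g x‖ₑ ≤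
      (∫⁻ x, ‖w x‖ₑ ^ q) ^ (1 - 1 / p) * (∫⁻ x, ‖g x‖ₑ ^ p) ^ (1 / p) := by
  have hp0 : 0 < p := by linarith
  have h1 : 1 / p ≤ 1 := by rw [div_le_one hp0]; exact hp
  have := ENNReal.lintegral_mul_norm_pow_le (μ := (volume : Measure (Fin N → ℝ)))
    (f := fun x => ‖w x‖ₑ ^ q) (g := fun x => ‖g x‖ₑ ^ p) (p := 1 - 1 / p) (q := 1 / p)
    ((hw.measurable.enorm.pow_const _).aemeasurable)
    ((hg.measurable.enorm.pow_const _).aemeasurable) (by linarith) (by positivity) (by ring)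
  refine le_trans (le_of_eq (lintegral_congr fun x => ?_)) this
  rw [← ENNReal.rpow_mul, ← ENNReal.rpow_mul, mul_one_div_cancel hp0.ne', ENNReal.rpow_one]

theorem lintegral_rpow_ne_top_of_hasCompactSupport {N : ℕ} {w : (Fin N → ℝ) → ℝ}
    (hw : Continuous w) (hwc : HasCompactSupport w) {q : ℝ} (hq : 0 < q) :
    ∫⁻ x, ‖w x‖ₑ ^ q ≠ ⊤ := by
  have h : MemLp w (ENNReal.ofReal q) := hw.memLp_of_hasCompactSupport hwc
  have := lintegral_rpow_enorm_lt_top_of_eLpNorm_lt_top (by simpa using hq) ENNReal.ofReal_ne_top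
    h.2
  rw [ENNReal.toReal_ofReal hq.le] at this
  exact this.ne

/-- Gagliardo's inequality combined with Hölder, then absorption. Positive finite bounds `K i`
replace the derivative integrals because the normalisation in the Gagliardo step divides by
quantities that must be neither zero nor infinite. -/
theorem exists_sobolev_of_contDiff {N : ℕ} {p : Fin N → ℝ} (hN : 0 < N) (hp : ∀ i, 1 ≤ p i)
    (hP : harmonicMean p < N) :
    ∃ C : ℝ≥0∞, C ≠ ⊤ ∧ ∀ w : (Fin N → ℝ) → ℝ, ContDiff ℝ 1 w → HasCompactSupport w →
      ∀ K : Fin N → ℝ≥0∞, (∀ i, K i ≠ 0) → (∀ i, K i ≠ ⊤) →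
      (∀ i, ∫⁻ x, ‖fderiv ℝ w x (Pi.single i 1)‖ₑ ^ p i ≤ K i) →
      (∫⁻ x, ‖w x‖ₑ ^ sobolevExponent p) ^ (1 - harmonicMean p / N) ≤
        C * ∏ i, K i ^ (harmonicMean p / (N * p i)) := by
  have hN1 := one_lt_dim hN hp hP
  have hP1 := one_le_harmonicMean hN hp
  have hsum := sum_one_div_eq hN hp
  set P := harmonicMean p with hPdef
  have hP0 : 0 < P := by linarith
  have hN0 : (0 : ℝ) < N := by linarith
  have hNP : 0 < (N : ℝ) - P := by linarith
  have hN1' : 0 < (N : ℝ) - 1 := by linarith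
  set q := sobolevExponent p with hqdef
  have hq : q = N * P / (N - P) := rfl
  have hq0 : 0 < q := by rw [hq]; positivity
  set r : ℝ := 1 / ((N : ℝ) - 1) with hr
  have hr0 : 0 < r := by rw [hr]; positivity
  -- Chosen so that `γ i - 1 = q (1 - 1 / p i)`, which is what Hölder against `‖Dᵢw‖` in `L^{p i}`
  -- requires; the `γ i * r` then sum to `q`.
  set γ : Fin N → ℝ := fun i => 1 + q * (1 - 1 / p i) with hγ
  have hp0 : ∀ i, 0 < p i := fun i => zero_lt_one.trans_le (hp i)
  have hpi : ∀ i, 0 ≤ 1 - 1 / p i := fun i => by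
    rw [sub_nonneg, div_le_one (hp0 i)]; exact hp i
  have hγ1 : ∀ i, 1 ≤ γ i := fun i => by
    have := mul_nonneg hq0.le (hpi i)
    simp only [hγ]; linarith
  have hsum1 : ∑ i, (1 - 1 / p i) = N - N / P := by
    rw [Finset.sum_sub_distrib, hsum]; simp
  have hγsum : ∑ i, γ i * r = q := by
    rw [← Finset.sum_mul]
    simp only [hγ, Finset.sum_add_distrib, ← Finset.mul_sum, hsum1]
    simp only [Finset.sum_const, Finset.card_univ, Fintype.card_fin, nsmul_eq_mul, mul_one]
    rw [hr, hq]
    field_simp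
    ring
  have hH : Real.HolderConjugate (Fintype.card (Fin N)) (N / (N - 1)) := by
    rw [Fintype.card_fin]
    exact Real.HolderConjugate.conjExponent hN1
  -- The power that turns the exponent left on `A` after absorption, `(N - P) / ((N - 1) P)`, into
  -- `1 - P / N`.
  set e : ℝ := P / (r * N) with he
  have he0 : 0 < e := by positivity
  set D : ℝ≥0∞ := (N : ℝ≥0∞) ^ ((N : ℝ) / (N - 1)) * ∏ i, ENNReal.ofReal (γ i) ^ r with hD
  have hDt : D ≠ ⊤ := by
    refine ENNReal.mul_ne_top ?_ ?_
    · exact ENNReal.rpow_ne_top_of_nonneg (by positivity) (ENNReal.natCast_ne_top N)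
    · exact ENNReal.prod_ne_top fun i _ =>
        ENNReal.rpow_ne_top_of_nonneg hr0.le ENNReal.ofReal_ne_top
  refine ⟨D ^ e, ENNReal.rpow_ne_top_of_nonneg he0.le hDt, ?_⟩
  intro w hw hwc K hK0 hKt hK
  set A := ∫⁻ x, ‖w x‖ₑ ^ q with hA
  have hAt : A ≠ ⊤ := lintegral_rpow_ne_top_of_hasCompactSupport hw.continuous hwc hq0
  have hexp : 0 < 1 - P / N := by rw [sub_pos, div_lt_one hN0]; exact hP
  rcases eq_or_ne A 0 with hA0 | hA0
  · rw [hA0, ENNReal.zero_rpow_of_pos hexp]; exact zero_le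
  have hcd : ∀ i, Continuous fun x => fderiv ℝ w x (Pi.single i 1) := fun i =>
    (hw.continuous_fderiv one_ne_zero).clm_apply continuous_const
  set f : Fin N → (Fin N → ℝ) → ℝ≥0∞ := fun i x =>
    ENNReal.ofReal (γ i) * (‖w x‖ₑ ^ (γ i - 1) * ‖fderiv ℝ w x (Pi.single i 1)‖ₑ) with hf
  have hfm : ∀ i, Measurable (f i) := fun i =>
    ((hw.continuous.measurable.enorm.pow_const _).mul (hcd i).measurable.enorm).const_mul _
  set B : Fin N → ℝ≥0∞ := fun i =>
    ENNReal.ofReal (γ i) * (A ^ (1 - 1 / p i) * K i ^ (1 / p i)) with hB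
  have hγpos : ∀ i, 0 < γ i := fun i => by linarith [hγ1 i]
  have hB0 : ∀ i, B i ≠ 0 := fun i => by
    refine mul_ne_zero (by simpa using hγpos i) (mul_ne_zero ?_ ?_)
    · exact (ENNReal.rpow_pos (pos_iff_ne_zero.2 hA0) hAt).ne'
    · exact (ENNReal.rpow_pos (pos_iff_ne_zero.2 (hK0 i)) (hKt i)).ne'
  have hBt : ∀ i, B i ≠ ⊤ := fun i => by
    refine ENNReal.mul_ne_top ENNReal.ofReal_ne_top (ENNReal.mul_ne_top ?_ ?_)
    · exact ENNReal.rpow_ne_top_of_nonneg (hpi i) hAt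
    · exact ENNReal.rpow_ne_top_of_nonneg (one_div_nonneg.2 (hp0 i).le) (hKt i)
  have hfB : ∀ i, ∫⁻ x, f i x ≤ B i := fun i => by
    simp only [hf, hB]
    rw [lintegral_const_mul' _ _ ENNReal.ofReal_ne_top]
    gcongr
    have := lintegral_rpow_mul_le_of_contDiff (q := q) hw.continuous (hcd i) (hp i)
    have hg : γ i - 1 = q * (1 - 1 / p i) := by simp only [hγ]; ring
    rw [hg]
    refine this.trans ?_
    gcongr
    · exact one_div_nonneg.2 (hp0 i).le
    · exact hK i
  have main := lintegral_prod_lintegral_rpow_le hH hfm hB0 hBt hfB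
  rw [Fintype.card_fin, ← hr] at main
  have step : A ≤ ∫⁻ x : Fin N → ℝ, ∏ i, (∫⁻ t, f i (Function.update x i t)) ^ r := by
    rw [hA]
    refine lintegral_mono fun x => ?_
    dsimp only
    rw [← hγsum, ← prod_rpow_eq_rpow_sum _ _ fun i _ => mul_nonneg (hγpos i).le hr0.le]
    refine Finset.prod_le_prod' fun i _ => ?_
    rw [ENNReal.rpow_mul]
    exact ENNReal.rpow_le_rpow (enorm_rpow_le_lintegral_update hw hwc (hγ1 i) i x) hr0.le
  have hprod : ∏ i, B i ^ r = (∏ i, ENNReal.ofReal (γ i) ^ r) *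
      (A ^ (r * (N - N / P)) * ∏ i, K i ^ (r / p i)) := by
    have hs : ∑ i, (1 - 1 / p i) * r = r * (N - N / P) := by
      rw [← Finset.sum_mul, hsum1]; ring
    rw [← hs, ← prod_rpow_eq_rpow_sum _ _ fun i _ => mul_nonneg (hpi i) hr0.le,
      ← Finset.prod_mul_distrib, ← Finset.prod_mul_distrib]
    refine Finset.prod_congr rfl fun i _ => ?_
    simp only [hB]
    rw [ENNReal.mul_rpow_of_nonneg _ _ hr0.le, ENNReal.mul_rpow_of_nonneg _ _ hr0.le,
      ← ENNReal.rpow_mul, ← ENNReal.rpow_mul]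
    rw [show 1 / p i * r = r / p i by ring]
  have h2 : A ≤ D * (A ^ (r * (N - N / P)) * ∏ i, K i ^ (r / p i)) := by
    refine (step.trans main).trans_eq ?_
    rw [hprod, hD, mul_assoc]
  -- Absorption: dividing by the power of `A` is legitimate because `0 < A < ∞`.
  have h3 : A ^ (1 - r * (N - N / P)) ≤ D * ∏ i, K i ^ (r / p i) := by
    calc A ^ (1 - r * (N - N / P)) = A * A ^ (-(r * (N - N / P))) := by
          rw [sub_eq_add_neg, ENNReal.rpow_add _ _ hA0 hAt, ENNReal.rpow_one]
      _ ≤ (D * (A ^ (r * (N - N / P)) * ∏ i, K i ^ (r / p i))) * A ^ (-(r * (N - N / P))) := by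
          gcongr
      _ = (A ^ (r * (N - N / P)) * A ^ (-(r * (N - N / P)))) * (D * ∏ i, K i ^ (r / p i)) := by
          ring
      _ = _ := by
          rw [← ENNReal.rpow_add _ _ hA0 hAt, add_neg_cancel, ENNReal.rpow_zero, one_mul]
  have h4 := ENNReal.rpow_le_rpow h3 he0.le
  rw [← ENNReal.rpow_mul, ENNReal.mul_rpow_of_nonneg _ _ he0.le,
    ← ENNReal.prod_rpow_of_nonneg he0.le] at h4
  have e1 : (1 - r * (N - N / P)) * e = 1 - P / N := by
    rw [he, hr]; field_simp; ring
  have e2 : ∀ i, (K i ^ (r / p i)) ^ e = K i ^ (P / (N * p i)) := fun i => by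
    rw [← ENNReal.rpow_mul]; congr 1
    have := hp0 i
    rw [he]; field_simp
  rw [e1] at h4
  simpa only [e2] using h4

end AnisoParabolic

/-! ### Removal of positivity, and extension to weak derivatives by mollification -/

namespace AnisoParabolic

open Filter Topology Convolution ContinuousLinearMap

/-- The anisotropic Sobolev inequality of Troisi for `C¹` functions with compact support. -/
theorem exists_sobolev_of_contDiff' {N : ℕ} {p : Fin N → ℝ} (hN : 0 < N) (hp : ∀ i, 1 ≤ p i)
    (hP : harmonicMean p < N) :
    ∃ C : ℝ≥0∞, C ≠ ⊤ ∧ ∀ w : (Fin N → ℝ) → ℝ, ContDiff ℝ 1 w → HasCompactSupport w →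
      (∫⁻ x, ‖w x‖ₑ ^ sobolevExponent p) ^ (1 - harmonicMean p / N) ≤
        C * ∏ i, (∫⁻ x, ‖fderiv ℝ w x (Pi.single i 1)‖ₑ ^ p i) ^
          (harmonicMean p / (N * p i)) := by
  obtain ⟨C, hC, h⟩ := exists_sobolev_of_contDiff hN hp hP
  refine ⟨C, hC, fun w hw hwc => ?_⟩
  have hp0 : ∀ i, 0 < p i := fun i => zero_lt_one.trans_le (hp i)
  have hP1 := one_le_harmonicMean hN hp
  set H : Fin N → ℝ≥0∞ := fun i => ∫⁻ x, ‖fderiv ℝ w x (Pi.single i 1)‖ₑ ^ p i with hH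
  have hHt : ∀ i, H i ≠ ⊤ := fun i =>
    lintegral_rpow_ne_top_of_hasCompactSupport
      ((hw.continuous_fderiv one_ne_zero).clm_apply continuous_const)
      (hwc.fderiv_apply (𝕜 := ℝ) _) (hp0 i)
  have hθ : ∀ i, 0 ≤ harmonicMean p / (N * p i) := fun i => by
    have := hp0 i; positivity
  -- A derivative integral may vanish, so the positive bounds are `H i + 1/n` and `n → ∞`.
  have hε : Tendsto (fun n : ℕ => ((n : ℝ≥0∞))⁻¹) atTop (𝓝 0) :=
    ENNReal.tendsto_inv_nat_nhds_zero
  have hlim : Tendsto (fun n : ℕ => C * ∏ i, (H i + (n : ℝ≥0∞)⁻¹) ^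
      (harmonicMean p / (N * p i))) atTop
      (𝓝 (C * ∏ i, (H i) ^ (harmonicMean p / (N * p i)))) := by
    refine ENNReal.Tendsto.const_mul ?_ (Or.inr hC)
    refine ENNReal.tendsto_finsetProd_of_ne_top _ (fun i _ => ?_)
      fun i _ => ENNReal.rpow_ne_top_of_nonneg (hθ i) (hHt i)
    have h1 : Tendsto (fun n : ℕ => H i + (n : ℝ≥0∞)⁻¹) atTop (𝓝 (H i + 0)) :=
      tendsto_const_nhds.add hε
    rw [add_zero] at h1
    exact (ENNReal.continuous_rpow_const.tendsto _).comp h1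
  refine ge_of_tendsto hlim ?_
  filter_upwards [eventually_gt_atTop 0] with n hn
  refine h w hw hwc _ (fun i => ?_) (fun i => ?_) fun i => le_self_add
  · simp
  · refine ENNReal.add_ne_top.2 ⟨hHt i, ?_⟩
    simpa using hn.ne'

/-- Mollification does not increase the `L^p` norm. -/
theorem lintegral_rpow_convolution_le {N : ℕ} (φ : ContDiffBump (0 : Fin N → ℝ))
    {g : (Fin N → ℝ) → ℝ} (hg : AEStronglyMeasurable g) {p : ℝ} (hp : 1 ≤ p) :
    ∫⁻ x, ‖(φ.normed volume ⋆[lsmul ℝ ℝ, volume] g) x‖ₑ ^ p ≤ ∫⁻ x, ‖g x‖ₑ ^ p := by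
  have hp0 : 0 < p := by linarith
  have h1 : 1 / p ≤ 1 := by rw [div_le_one hp0]; exact hp
  set ρ := φ.normed (volume : Measure (Fin N → ℝ)) with hρ
  have hρm : Measurable ρ := φ.continuous_normed.measurable
  have hρ1 : ∫⁻ t, ‖ρ t‖ₑ = 1 := by
    have h := ofReal_integral_eq_lintegral_ofReal (φ.integrable_normed (μ := volume))
      (Eventually.of_forall φ.nonneg_normed)
    rw [φ.integral_normed, ENNReal.ofReal_one] at h
    rw [h]
    exact lintegral_congr fun t => Real.enorm_of_nonneg (φ.nonneg_normed t)
  have hsub : ∀ x, AEMeasurable (fun t => ‖g (x - t)‖ₑ) volume := fun x =>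
    (hg.comp_quasiMeasurePreserving
      (quasiMeasurePreserving_sub_left_of_right_invariant volume x)).enorm
  have hpt : ∀ x, ‖(ρ ⋆[lsmul ℝ ℝ, volume] g) x‖ₑ ^ p ≤ ∫⁻ t, ‖ρ t‖ₑ * ‖g (x - t)‖ₑ ^ p := by
    intro x
    have h2 : ‖(ρ ⋆[lsmul ℝ ℝ, volume] g) x‖ₑ ≤
        (∫⁻ t, ‖ρ t‖ₑ * ‖g (x - t)‖ₑ ^ p) ^ (1 / p) := by
      calc ‖(ρ ⋆[lsmul ℝ ℝ, volume] g) x‖ₑ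
          ≤ ∫⁻ t, ‖ρ t‖ₑ * ‖g (x - t)‖ₑ := by
            refine (enorm_integral_le_lintegral_enorm _).trans_eq (lintegral_congr fun t => ?_)
            simp [enorm_mul]
        -- Splitting `ρ` as `ρ^(1/p) ρ^(1-1/p)` prepares Hölder; with `∫ ρ = 1` this is Jensen's
        -- inequality.
        _ = ∫⁻ t, (‖ρ t‖ₑ * ‖g (x - t)‖ₑ ^ p) ^ (1 / p) * ‖ρ t‖ₑ ^ (1 - 1 / p) := by
            refine lintegral_congr fun t => ?_
            rw [ENNReal.mul_rpow_of_nonneg _ _ (by positivity), ← ENNReal.rpow_mul,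
              mul_one_div_cancel hp0.ne', ENNReal.rpow_one, mul_right_comm,
              ← ENNReal.rpow_add_of_nonneg _ _ (by positivity) (by linarith),
              add_sub_cancel, ENNReal.rpow_one]
        _ ≤ (∫⁻ t, ‖ρ t‖ₑ * ‖g (x - t)‖ₑ ^ p) ^ (1 / p) * (∫⁻ t, ‖ρ t‖ₑ) ^ (1 - 1 / p) :=
            ENNReal.lintegral_mul_norm_pow_le
              (hρm.enorm.aemeasurable.mul ((hsub x).pow_const _)) hρm.enorm.aemeasurable
              (by positivity) (by linarith) (by ring)
        _ = _ := by rw [hρ1, ENNReal.one_rpow, mul_one]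
    have h3 := ENNReal.rpow_le_rpow h2 hp0.le
    rwa [← ENNReal.rpow_mul, one_div_mul_cancel hp0.ne', ENNReal.rpow_one] at h3
  have hprod : AEMeasurable (Function.uncurry fun x t => ‖ρ t‖ₑ * ‖g (x - t)‖ₑ ^ p)
      ((volume : Measure (Fin N → ℝ)).prod volume) := by
    refine AEMeasurable.mul ?_ (AEMeasurable.pow_const ?_ _)
    · exact (hρm.comp measurable_snd).enorm.aemeasurable
    · exact (hg.comp_quasiMeasurePreserving
        (quasiMeasurePreserving_sub_of_right_invariant volume volume)).enorm
  calc ∫⁻ x, ‖(ρ ⋆[lsmul ℝ ℝ, volume] g) x‖ₑ ^ p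
      ≤ ∫⁻ x, ∫⁻ t, ‖ρ t‖ₑ * ‖g (x - t)‖ₑ ^ p := lintegral_mono hpt
    _ = ∫⁻ t, ∫⁻ x, ‖ρ t‖ₑ * ‖g (x - t)‖ₑ ^ p := lintegral_lintegral_swap hprod
    _ = ∫⁻ t, ‖ρ t‖ₑ * ∫⁻ x, ‖g x‖ₑ ^ p := by
        refine lintegral_congr fun t => ?_
        rw [lintegral_const_mul' _ _ enorm_ne_top]
        congr 1
        exact lintegral_sub_right_eq_self (fun x => ‖g x‖ₑ ^ p) t
    _ = _ := by rw [lintegral_mul_const _ hρm.enorm, hρ1, one_mul]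

/-- Differentiation falls on the mollifier, and `y ↦ ρ (x - y)` is an admissible test function; the
sign from the reflection cancels the sign in the weak derivative. -/
theorem HasWeakPartialDeriv.fderiv_convolution {N : ℕ} {i : Fin N} {v g : (Fin N → ℝ) → ℝ}
    (h : HasWeakPartialDeriv i v g) (φ : ContDiffBump (0 : Fin N → ℝ)) (x : Fin N → ℝ) :
    fderiv ℝ (φ.normed volume ⋆[lsmul ℝ ℝ, volume] v) x (Pi.single i 1) =
      (φ.normed volume ⋆[lsmul ℝ ℝ, volume] g) x := by
  set ρ := φ.normed (volume : Measure (Fin N → ℝ)) with hρ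
  have hρc : HasCompactSupport ρ := φ.hasCompactSupport_normed
  have hρd : ContDiff ℝ ∞ ρ := φ.contDiff_normed
  have hρ1 : ContDiff ℝ 1 ρ := hρd.of_le (by exact_mod_cast le_top)
  rw [(hρc.hasFDerivAt_convolution_left (lsmul ℝ ℝ) hρ1 h.1 x).fderiv,
    convolution_eq_swap, convolution_eq_swap, ContinuousLinearMap.integral_apply]
  · have hψ : ContDiff ℝ ∞ fun y => ρ (x - y) := hρd.comp (contDiff_const.sub contDiff_id)
    have hψc : HasCompactSupport fun y => ρ (x - y) :=
      hρc.comp_homeomorph (Homeomorph.subLeft x)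
    have hd : ∀ y, fderiv ℝ (fun y => ρ (x - y)) y (Pi.single i 1) =
        -fderiv ℝ ρ (x - y) (Pi.single i 1) := by
      intro y
      have h1 := ((hρ1.differentiable one_ne_zero (x - y)).hasFDerivAt).comp y
        ((hasFDerivAt_id y).const_sub x)
      have h2 : fderiv ℝ (fun y => ρ (x - y)) y = _ := h1.fderiv
      rw [h2]; simp
    have key := h.2.2 _ hψ hψc
    simp only [hd, mul_neg, integral_neg, neg_inj] at key
    simp only [precompL_apply, lsmul_apply, smul_eq_mul]
    simpa only [mul_comm] using key
  · have hex : ConvolutionExists (fderiv ℝ ρ) v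
        (precompL (Fin N → ℝ) (lsmul ℝ ℝ : ℝ →L[ℝ] ℝ →L[ℝ] ℝ)) volume :=
      HasCompactSupport.convolutionExists_left _ (hρc.fderiv (𝕜 := ℝ))
        (hρ1.continuous_fderiv one_ne_zero) h.1
    exact (hex x).integrable_swap

/-- The anisotropic Sobolev inequality for weakly differentiable functions with compact support. -/
theorem exists_sobolev_of_hasWeakPartialDeriv {N : ℕ} {p : Fin N → ℝ} (hN : 0 < N)
    (hp : ∀ i, 1 ≤ p i) (hP : harmonicMean p < N) :
    ∃ C : ℝ≥0∞, C ≠ ⊤ ∧ ∀ (w : (Fin N → ℝ) → ℝ) (h : Fin N → (Fin N → ℝ) → ℝ),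
      HasCompactSupport w → (∀ i, HasWeakPartialDeriv i w (h i)) →
      (∫⁻ x, ‖w x‖ₑ ^ sobolevExponent p) ^ (1 - harmonicMean p / N) ≤
        C * ∏ i, (∫⁻ x, ‖h i x‖ₑ ^ p i) ^ (harmonicMean p / (N * p i)) := by
  obtain ⟨C, hC, H⟩ := exists_sobolev_of_contDiff' hN hp hP
  refine ⟨C, hC, fun w h hwc hw => ?_⟩
  have hN0 : (0 : ℝ) < N := by exact_mod_cast hN
  have hP1 := one_le_harmonicMean hN hp
  have ha : 0 < 1 - harmonicMean p / N := by rw [sub_pos, div_lt_one hN0]; exact hP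
  have hwl : LocallyIntegrable w := (hw ⟨0, hN⟩).1
  set R := C * ∏ i, (∫⁻ x, ‖h i x‖ₑ ^ p i) ^ (harmonicMean p / (N * p i)) with hR
  -- The fixed ratio 2 of outer to inner radius is what the almost everywhere convergence of
  -- mollifications uses.
  let φ : ℕ → ContDiffBump (0 : Fin N → ℝ) := fun n =>
    ⟨1 / ((n : ℝ) + 1), 2 * (1 / ((n : ℝ) + 1)), by positivity, by
      have : 0 < 1 / ((n : ℝ) + 1) := by positivity
      linarith⟩
  have hφ : Tendsto (fun n => (φ n).rOut) atTop (𝓝 0) := by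
    have := (tendsto_one_div_add_atTop_nhds_zero_nat (𝕜 := ℝ)).const_mul 2
    simpa only [mul_zero] using this
  have hae := ContDiffBump.ae_convolution_tendsto_right_of_locallyIntegrable (μ := volume)
    (K := 2) hφ (Eventually.of_forall fun n => le_rfl) hwl
  set W : ℕ → (Fin N → ℝ) → ℝ := fun n => (φ n).normed volume ⋆[lsmul ℝ ℝ, volume] w with hW
  have hWd : ∀ n, ContDiff ℝ 1 (W n) := fun n =>
    ((φ n).hasCompactSupport_normed.contDiff_convolution_left (n := 1) _
      (φ n).contDiff_normed hwl)
  have hWb : ∀ n, ∫⁻ x, ‖W n x‖ₑ ^ sobolevExponent p ≤ R ^ (1 - harmonicMean p / N)⁻¹ := by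
    intro n
    rw [ENNReal.le_rpow_inv_iff ha]
    refine (H (W n) (hWd n) ((φ n).hasCompactSupport_normed.convolution _ hwc)).trans ?_
    rw [hR]
    gcongr C * ∏ i, ?_ ^ _ with i
    · have := zero_lt_one.trans_le (hp i)
      positivity
    · simp only [hW, (hw i).fderiv_convolution]
      exact lintegral_rpow_convolution_le _ (hw i).2.1.aestronglyMeasurable (hp i)
  rw [← ENNReal.le_rpow_inv_iff ha]
  -- Fatou's lemma along the mollifications, whose integrals are bounded uniformly.
  calc ∫⁻ x, ‖w x‖ₑ ^ sobolevExponent p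
      = ∫⁻ x, liminf (fun n => ‖W n x‖ₑ ^ sobolevExponent p) atTop := by
        refine lintegral_congr_ae ?_
        filter_upwards [hae] with x hx
        refine (Tendsto.liminf_eq ?_).symm
        exact (ENNReal.continuous_rpow_const.tendsto _).comp hx.enorm
    _ ≤ liminf (fun n => ∫⁻ x, ‖W n x‖ₑ ^ sobolevExponent p) atTop :=
        lintegral_liminf_le fun n => (hWd n).continuous.measurable.enorm.pow_const _
    _ ≤ R ^ (1 - harmonicMean p / N)⁻¹ := by
        refine (liminf_le_liminf (Eventually.of_forall hWb)).trans ?_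
        simp

end AnisoParabolic

/-! ### Cutoff, interpolation on time slices and the space-time inequality -/

namespace AnisoParabolic

open Filter Topology

/-- The product rule for a weak derivative and a smooth cutoff. -/
theorem HasWeakPartialDeriv.cutoff {N : ℕ} {i : Fin N} {v g η : (Fin N → ℝ) → ℝ}
    (h : HasWeakPartialDeriv i v g) (hη : ContDiff ℝ ∞ η) (hηc : HasCompactSupport η) :
    HasWeakPartialDeriv i (fun x => η x * v x)
      (fun x => η x * g x + fderiv ℝ η x (Pi.single i 1) * v x) := by
  obtain ⟨hv, hg, hint⟩ := h
  have hη' : Continuous fun x => fderiv ℝ η x (Pi.single i 1) :=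
    (hη.continuous_fderiv (by simp)).clm_apply continuous_const
  have hη'c : HasCompactSupport fun x => fderiv ℝ η x (Pi.single i 1) :=
    hηc.fderiv_apply (𝕜 := ℝ) _
  have hvη := hv.integrable_smul_left_of_hasCompactSupport hη.continuous hηc
  have hgη := hg.integrable_smul_left_of_hasCompactSupport hη.continuous hηc
  have hvη' := hv.integrable_smul_left_of_hasCompactSupport hη' hη'c
  refine ⟨hvη.locallyIntegrable, (hgη.add hvη').locallyIntegrable, fun φ hφ hφc => ?_⟩
  have hφ' : Continuous fun x => fderiv ℝ φ x (Pi.single i 1) :=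
    (hφ.continuous_fderiv (by simp)).clm_apply continuous_const
  have key := hint (fun x => η x * φ x) (hη.mul hφ) (hφc.mul_left)
  have hd : ∀ x, fderiv ℝ (fun x => η x * φ x) x (Pi.single i 1) =
      η x * fderiv ℝ φ x (Pi.single i 1) + φ x * fderiv ℝ η x (Pi.single i 1) := by
    intro x
    rw [fderiv_fun_mul (hη.differentiable (by simp) x) (hφ.differentiable (by simp) x)]
    simp
  have i1 : Integrable fun x => v x * (η x * fderiv ℝ φ x (Pi.single i 1)) := by
    have := hv.integrable_smul_left_of_hasCompactSupport (hη.continuous.mul hφ')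
      (hηc.mul_right (f' := fun x => fderiv ℝ φ x (Pi.single i 1)))
    simpa [mul_comm] using this
  have i2 : Integrable fun x => v x * (φ x * fderiv ℝ η x (Pi.single i 1)) := by
    have := hv.integrable_smul_left_of_hasCompactSupport (hφ.continuous.mul hη')
      (hφc.mul_right (f' := fun x => fderiv ℝ η x (Pi.single i 1)))
    simpa [mul_comm] using this
  have i3 : Integrable fun x => g x * (η x * φ x) := by
    have := hg.integrable_smul_left_of_hasCompactSupport (hη.continuous.mul hφ.continuous)
      (hηc.mul_right (f' := φ))
    simpa [mul_comm] using this
  simp only [hd, mul_add] at key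
  rw [integral_add i1 i2] at key
  have e1 : ∫ x, η x * v x * fderiv ℝ φ x (Pi.single i 1) =
      ∫ x, v x * (η x * fderiv ℝ φ x (Pi.single i 1)) :=
    integral_congr_ae (Eventually.of_forall fun x => by dsimp only; ring)
  have e2 : ∫ x, (η x * g x + fderiv ℝ η x (Pi.single i 1) * v x) * φ x =
      (∫ x, g x * (η x * φ x)) + ∫ x, v x * (φ x * fderiv ℝ η x (Pi.single i 1)) := by
    rw [← integral_add i3 i2]
    exact integral_congr_ae (Eventually.of_forall fun x => by dsimp only; ring)
  rw [e1, e2]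
  linarith

/-- Hölder with weights `1 - p̄/N` and `p̄/N`: since `p̄* (1 - p̄/N) = p̄`, the exponents combine to
`p̄ + σ p̄/N = p̄_σ`. -/
theorem lintegral_rpow_criticalExponent_le {N : ℕ} {p : Fin N → ℝ} (hN : 0 < N)
    (hp : ∀ i, 1 ≤ p i) (hP : harmonicMean p < N) {σ : ℝ} (hσ : 0 ≤ σ)
    {w : (Fin N → ℝ) → ℝ} (hw : AEStronglyMeasurable w) :
    ∫⁻ x, ‖w x‖ₑ ^ criticalExponent p σ ≤
      (∫⁻ x, ‖w x‖ₑ ^ sobolevExponent p) ^ (1 - harmonicMean p / N) *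
        (∫⁻ x, ‖w x‖ₑ ^ σ) ^ (harmonicMean p / N) := by
  have hN0 : (0 : ℝ) < N := by exact_mod_cast hN
  have hP1 := one_le_harmonicMean hN hp
  have ha : 0 < 1 - harmonicMean p / N := by rw [sub_pos, div_lt_one hN0]; exact hP
  have hNP : 0 < (N : ℝ) - harmonicMean p := by linarith
  refine le_trans (le_of_eq (lintegral_congr fun x => ?_))
    (ENNReal.lintegral_mul_norm_pow_le (hw.enorm.pow_const (sobolevExponent p))
      (hw.enorm.pow_const σ) ha.le (by positivity) (by ring))
  have e : sobolevExponent p * (1 - harmonicMean p / N) = harmonicMean p := by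
    rw [sobolevExponent]; field_simp
  rw [← ENNReal.rpow_mul, ← ENNReal.rpow_mul, e,
    ← ENNReal.rpow_add_of_nonneg _ _ (by positivity) (by positivity), criticalExponent]
  congr 1; ring

theorem restrict_univ_prod_eq {N : ℕ} (T : ℝ) :
    (volume : Measure ((Fin N → ℝ) × ℝ)).restrict (univ ×ˢ Ioo 0 T) =
      (volume : Measure (Fin N → ℝ)).prod (volume.restrict (Ioo 0 T)) := by
  rw [Measure.volume_eq_prod, ← Measure.prod_restrict, Measure.restrict_univ]

/-- Interpolation and Sobolev on almost every slice, followed by Hölder in time for a product of `N`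
functions with weights `p̄/(N pᵢ)`. -/
theorem exists_lintegral_criticalExponent_le {N : ℕ} {p : Fin N → ℝ} (hN : 0 < N)
    (hp : ∀ i, 1 ≤ p i) (hP : harmonicMean p < N) {σ : ℝ} (hσ : 0 ≤ σ) :
    ∃ C : ℝ≥0∞, C ≠ ⊤ ∧ ∀ (T : ℝ) (W : (Fin N → ℝ) × ℝ → ℝ)
      (h : Fin N → (Fin N → ℝ) × ℝ → ℝ) (M : ℝ≥0∞), M ≠ ⊤ →
      AEStronglyMeasurable W (volume.restrict (univ ×ˢ Ioo 0 T)) →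
      IsSpatialGradient T W h →
      (∀ t, HasCompactSupport fun x => W (x, t)) →
      (∀ᵐ t ∂(volume.restrict (Ioo 0 T)), ∫⁻ x, ‖W (x, t)‖ₑ ^ σ ≤ M) →
      ∫⁻ z in univ ×ˢ Ioo 0 T, ‖W z‖ₑ ^ criticalExponent p σ ≤
        C * M ^ (harmonicMean p / N) *
          ∏ i, (∫⁻ z in univ ×ˢ Ioo 0 T, ‖h i z‖ₑ ^ p i) ^ (harmonicMean p / (N * p i)) := by
  obtain ⟨C, hC, H⟩ := exists_sobolev_of_hasWeakPartialDeriv hN hp hP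
  refine ⟨C, hC, fun T W h M hM hW hgrad hWc hWM => ?_⟩
  have hN0 : (0 : ℝ) < N := by exact_mod_cast hN
  have hP1 := one_le_harmonicMean hN hp
  have hP0 : 0 < harmonicMean p := by linarith
  have hp0 : ∀ i, 0 < p i := fun i => zero_lt_one.trans_le (hp i)
  have hPN : 0 ≤ harmonicMean p / N := by positivity
  have hhm : ∀ i, AEStronglyMeasurable (h i) (volume.restrict (univ ×ˢ Ioo 0 T)) :=
    fun i => (hgrad i).1
  have hweak : ∀ᵐ t ∂(volume.restrict (Ioo 0 T)), ∀ i,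
      HasWeakPartialDeriv i (fun x => W (x, t)) (fun x => h i (x, t)) :=
    ae_all_iff.2 fun i => (hgrad i).2
  -- Sum 1 is the condition for Hölder in time; it is the definition of the harmonic mean.
  have hsum : ∑ i, harmonicMean p / (N * p i) = 1 := by
    have : ∀ i, harmonicMean p / (N * p i) = harmonicMean p / N * (1 / p i) := fun i => by
      have := hp0 i; field_simp
    simp only [this, ← Finset.mul_sum, sum_one_div_eq hN hp]
    field_simp
  rw [restrict_univ_prod_eq] at *
  have hm : ∀ i, AEMeasurable (fun t => ∫⁻ x, ‖h i (x, t)‖ₑ ^ p i) (volume.restrict (Ioo 0 T)) :=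
    fun i => ((hhm i).enorm.pow_const (p i)).lintegral_prod_left'
  rw [lintegral_prod_symm _ (hW.enorm.pow_const _)]
  calc ∫⁻ t in Ioo 0 T, ∫⁻ x, ‖W (x, t)‖ₑ ^ criticalExponent p σ
      ≤ ∫⁻ t in Ioo 0 T, C * M ^ (harmonicMean p / N) *
          ∏ i, (∫⁻ x, ‖h i (x, t)‖ₑ ^ p i) ^ (harmonicMean p / (N * p i)) := by
        refine lintegral_mono_ae ?_
        filter_upwards [hweak, hWM] with t ht htM
        refine (lintegral_rpow_criticalExponent_le hN hp hP hσ
          (ht ⟨0, hN⟩).1.aestronglyMeasurable).trans ?_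
        rw [mul_right_comm]
        gcongr
        exact H _ _ (hWc t) ht
    _ = C * M ^ (harmonicMean p / N) * ∫⁻ t in Ioo 0 T,
          ∏ i, (∫⁻ x, ‖h i (x, t)‖ₑ ^ p i) ^ (harmonicMean p / (N * p i)) :=
        lintegral_const_mul' _ _ (ENNReal.mul_ne_top hC (ENNReal.rpow_ne_top_of_nonneg hPN hM))
    _ ≤ C * M ^ (harmonicMean p / N) *
          ∏ i, (∫⁻ t in Ioo 0 T, ∫⁻ x, ‖h i (x, t)‖ₑ ^ p i) ^ (harmonicMean p / (N * p i)) := by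
        gcongr
        refine ENNReal.lintegral_prod_norm_pow_le _ (fun i _ => hm i) hsum fun i _ => ?_
        have := hp0 i
        positivity
    _ = _ := by
        congr 1
        refine Finset.prod_congr rfl fun i _ => ?_
        rw [lintegral_prod_symm _ ((hhm i).enorm.pow_const _)]

theorem eLpNorm_mul_le_of_bound {α : Type*} [MeasurableSpace α] {μ : Measure α} {a f : α → ℝ}
    {S : Set α} (hS : MeasurableSet S) {L : ℝ≥0} (haL : ∀ z, ‖a z‖ ≤ L) (ha : ∀ z ∉ S, a z = 0)
    (q : ℝ≥0∞) : eLpNorm (fun z => a z * f z) q μ ≤ L * eLpNorm f q (μ.restrict S) := by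
  rw [← eLpNorm_indicator_eq_eLpNorm_restrict hS, ← ENNReal.ofReal_coe_nnreal]
  refine eLpNorm_le_mul_eLpNorm_of_ae_le_mul (Eventually.of_forall fun z => ?_) q
  by_cases hz : z ∈ S
  · rw [indicator_of_mem hz, norm_mul]
    gcongr
    exact haL z
  · simp [ha z hz, indicator_of_notMem hz]

theorem lintegral_rpow_enorm_eq {α : Type*} [MeasurableSpace α] {μ : Measure α} {q : ℝ}
    (hq : 0 < q) (f : α → ℝ) :
    ∫⁻ z, ‖f z‖ₑ ^ q ∂μ = eLpNorm f (ENNReal.ofReal q) μ ^ q := by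
  rw [lintegral_rpow_enorm_eq_rpow_eLpNorm' hq,
    eLpNorm_eq_eLpNorm' (by simpa using hq) ENNReal.ofReal_ne_top, ENNReal.toReal_ofReal hq.le]

end AnisoParabolic

/-! ### Localisation -/

namespace AnisoParabolic

open Filter Topology

section Norms

variable {N : ℕ} {T : ℝ} {K K' : Set (Fin N → ℝ)}

theorem normLq_mono (h : K ⊆ K') (q : ℝ) (u : (Fin N → ℝ) × ℝ → ℝ) :
    normLq q T K u ≤ normLq q T K' u :=
  eLpNorm_mono_measure _ (Measure.restrict_mono (prod_mono h le_rfl) le_rfl)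

theorem normLinftyL_mono (h : K ⊆ K') (σ : ℝ) (u : (Fin N → ℝ) × ℝ → ℝ) :
    normLinftyL σ T K u ≤ normLinftyL σ T K' u :=
  essSup_mono_ae (Eventually.of_forall fun _ =>
    eLpNorm_mono_measure _ (Measure.restrict_mono h le_rfl))

theorem normLpW1_mono (h : K ⊆ K') (p : Fin N → ℝ) (u : (Fin N → ℝ) × ℝ → ℝ)
    (Du : Fin N → (Fin N → ℝ) × ℝ → ℝ) :
    normLpW1 p T K u Du ≤ normLpW1 p T K' u Du :=
  add_le_add (normLq_mono h _ _) (Finset.sum_le_sum fun _ _ => normLq_mono h _ _)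

theorem exists_normLq_le_of_exponent_le (hK : IsCompact K) (T : ℝ) {q r : ℝ} (hq : 0 < q)
    (hqr : q ≤ r) :
    ∃ C : ℝ≥0, ∀ u : (Fin N → ℝ) × ℝ → ℝ,
      AEStronglyMeasurable u (volume.restrict (univ ×ˢ Ioo 0 T)) →
      normLq q T K u ≤ C * normLq r T K u := by
  have hr : 0 < r := hq.trans_le hqr
  set V : ℝ≥0∞ := volume (K ×ˢ Ioo (0 : ℝ) T) with hV
  have hVt : V ≠ ⊤ := by
    have : V ≤ volume (K ×ˢ Icc (0 : ℝ) T) := measure_mono (prod_mono le_rfl Ioo_subset_Icc_self)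
    exact (this.trans_lt (hK.prod isCompact_Icc).measure_lt_top).ne
  have he : 0 ≤ 1 / q - 1 / r := sub_nonneg.2 (one_div_le_one_div_of_le hq hqr)
  have hVe : V ^ (1 / q - 1 / r) ≠ ⊤ := ENNReal.rpow_ne_top_of_nonneg he hVt
  refine ⟨(V ^ (1 / q - 1 / r)).toNNReal, fun u hu => ?_⟩
  have := eLpNorm_le_eLpNorm_mul_rpow_measure_univ (μ := volume.restrict (K ×ˢ Ioo (0 : ℝ) T))
    (ENNReal.ofReal_le_ofReal hqr)
    (hu.mono_measure (Measure.restrict_mono (prod_mono (subset_univ K) le_rfl) le_rfl))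
  rw [ENNReal.toReal_ofReal hq.le, ENNReal.toReal_ofReal hr.le, Measure.restrict_apply_univ,
    ← hV, mul_comm] at this
  rwa [ENNReal.coe_toNNReal hVe]

end Norms

theorem exists_cutoff {N : ℕ} {K : Set (Fin N → ℝ)} (hK : IsCompact K) :
    ∃ η : (Fin N → ℝ) → ℝ, ContDiff ℝ ∞ η ∧ HasCompactSupport η ∧ (∀ x, ‖η x‖ ≤ 1) ∧
      (∀ x ∈ K, η x = 1) := by
  obtain ⟨R, hR0, hR⟩ := hK.isBounded.subset_closedBall_lt 0 (0 : Fin N → ℝ)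
  let φ : ContDiffBump (0 : Fin N → ℝ) := ⟨R, R + 1, hR0, by linarith⟩
  refine ⟨φ, φ.contDiff, φ.hasCompactSupport, fun x => ?_, fun x hx => ?_⟩
  · rw [Real.norm_of_nonneg φ.nonneg]; exact φ.le_one
  · exact φ.one_of_mem_closedBall (hR hx)

theorem normLq_le_eLpNorm_cutoff {N : ℕ} {K : Set (Fin N → ℝ)} (hK : IsCompact K) (q T : ℝ)
    {η : (Fin N → ℝ) → ℝ} (hη : ∀ x ∈ K, η x = 1) (u : (Fin N → ℝ) × ℝ → ℝ) :
    normLq q T K u ≤ eLpNorm (fun z => η z.1 * u z) (ENNReal.ofReal q)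
      (volume.restrict (univ ×ˢ Ioo 0 T)) := by
  have : normLq q T K u = eLpNorm (fun z => η z.1 * u z) (ENNReal.ofReal q)
      (volume.restrict (K ×ˢ Ioo 0 T)) := by
    refine eLpNorm_congr_ae ?_
    filter_upwards [ae_restrict_mem (hK.measurableSet.prod measurableSet_Ioo)] with z hz
    rw [hη _ hz.1, one_mul]
  rw [this]
  exact eLpNorm_mono_measure _ (Measure.restrict_mono (prod_mono (subset_univ K) le_rfl) le_rfl)

theorem eLpNorm_mul_le_normLq {N : ℕ} {K : Set (Fin N → ℝ)} (hK : IsCompact K) (q T : ℝ)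
    {a : (Fin N → ℝ) → ℝ} {L : ℝ≥0} (haL : ∀ x, ‖a x‖ ≤ L) (ha : ∀ x ∉ K, a x = 0)
    (u : (Fin N → ℝ) × ℝ → ℝ) :
    eLpNorm (fun z => a z.1 * u z) (ENNReal.ofReal q) (volume.restrict (univ ×ˢ Ioo 0 T)) ≤
      L * normLq q T K u := by
  refine (eLpNorm_mul_le_of_bound (a := fun z : (Fin N → ℝ) × ℝ => a z.1) (S := K ×ˢ univ)
    (hK.measurableSet.prod MeasurableSet.univ) (fun z => haL z.1)
    (fun z hz => ha _ fun h => hz ⟨h, mem_univ _⟩) _).trans_eq ?_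
  rw [normLq, Measure.restrict_restrict (hK.measurableSet.prod MeasurableSet.univ), prod_inter_prod,
    inter_univ, univ_inter]

theorem eLpNorm_cutoff_gradient_le {N : ℕ} {K : Set (Fin N → ℝ)} (hK : IsCompact K) (T : ℝ)
    {p : ℝ} (hp : 1 ≤ p) {a b : (Fin N → ℝ) → ℝ} (hac : Continuous a) (hbc : Continuous b)
    {L : ℝ≥0} (ha1 : ∀ x, ‖a x‖ ≤ 1) (ha : ∀ x ∉ K, a x = 0)
    (hbL : ∀ x, ‖b x‖ ≤ L) (hb : ∀ x ∉ K, b x = 0) {u v : (Fin N → ℝ) × ℝ → ℝ}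
    (hu : AEStronglyMeasurable u (volume.restrict (univ ×ˢ Ioo 0 T)))
    (hv : AEStronglyMeasurable v (volume.restrict (univ ×ˢ Ioo 0 T))) :
    eLpNorm (fun z => a z.1 * v z + b z.1 * u z) (ENNReal.ofReal p)
        (volume.restrict (univ ×ˢ Ioo 0 T)) ≤
      normLq p T K v + L * normLq p T K u := by
  have h1 := eLpNorm_mul_le_normLq hK p T (L := 1) (by simpa using ha1) ha v
  have h2 := eLpNorm_mul_le_normLq hK p T hbL hb u
  rw [ENNReal.coe_one, one_mul] at h1
  refine (eLpNorm_add_le (f := fun z => a z.1 * v z) (g := fun z => b z.1 * u z) ?_ ?_ ?_).trans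
    (add_le_add h1 h2)
  · exact (hac.comp continuous_fst).aestronglyMeasurable.mul hv
  · exact (hbc.comp continuous_fst).aestronglyMeasurable.mul hu
  · simpa using hp

theorem IsSpatialGradient.cutoff {N : ℕ} {T : ℝ} {u : (Fin N → ℝ) × ℝ → ℝ}
    {Du : Fin N → (Fin N → ℝ) × ℝ → ℝ} (h : IsSpatialGradient T u Du)
    (hu : AEStronglyMeasurable u (volume.restrict (univ ×ˢ Ioo 0 T)))
    {η : (Fin N → ℝ) → ℝ} (hη : ContDiff ℝ ∞ η) (hηc : HasCompactSupport η) :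
    IsSpatialGradient T (fun z => η z.1 * u z)
      (fun i z => η z.1 * Du i z + fderiv ℝ η z.1 (Pi.single i 1) * u z) := by
  intro i
  have hη' : Continuous fun x => fderiv ℝ η x (Pi.single i 1) :=
    (hη.continuous_fderiv (by simp)).clm_apply continuous_const
  refine ⟨?_, ?_⟩
  · exact ((hη.continuous.comp continuous_fst).aestronglyMeasurable.mul (h i).1).add
      ((hη'.comp continuous_fst).aestronglyMeasurable.mul hu)
  · filter_upwards [(h i).2] with t ht
    exact ht.cutoff hη hηc

theorem criticalExponent_pos {N : ℕ} {p : Fin N → ℝ} (hN : 0 < N) (hp : ∀ i, 1 ≤ p i) {σ : ℝ}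
    (hσ : 0 ≤ σ) : 0 < criticalExponent p σ := by
  have hP1 := one_le_harmonicMean hN hp
  rw [criticalExponent]
  positivity

/-- The local parabolic embedding, given `L^m` control with `m` at least every `pᵢ`. -/
theorem exists_normLq_criticalExponent_le {N : ℕ} {p : Fin N → ℝ} (hN : 0 < N)
    (hp : ∀ i, 1 ≤ p i) (hP : harmonicMean p < N) {σ : ℝ} (hσ : 1 ≤ σ) {m : ℝ}
    (hm : ∀ i, p i ≤ m) (T : ℝ) {K : Set (Fin N → ℝ)} (hK : IsCompact K) :
    ∃ K' : Set (Fin N → ℝ), IsCompact K' ∧ ∃ C : ℝ≥0,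
      ∀ (u : (Fin N → ℝ) × ℝ → ℝ) (Du : Fin N → (Fin N → ℝ) × ℝ → ℝ),
        AEStronglyMeasurable u (volume.restrict (univ ×ˢ Ioo 0 T)) →
        IsSpatialGradient T u Du →
        normLq (criticalExponent p σ) T K u ≤
          C * (normLq m T K' u + ∑ i, normLq (p i) T K' (Du i) + normLinftyL σ T K' u) := by
  have hσ0 : 0 < σ := by linarith
  have hp0 : ∀ i, 0 < p i := fun i => zero_lt_one.trans_le (hp i)
  have hN0 : (0 : ℝ) < N := by exact_mod_cast hN
  have hP1 := one_le_harmonicMean hN hp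
  have hP0 : 0 < harmonicMean p := by linarith
  obtain ⟨η, hη, hηc, hη1, hηK⟩ := exists_cutoff hK
  obtain ⟨L₀, hL₀⟩ := (hηc.fderiv (𝕜 := ℝ)).exists_bound_of_continuous
    (hη.continuous_fderiv (by simp))
  set L := L₀.toNNReal with hL
  have hηL : ∀ i x, ‖fderiv ℝ η x (Pi.single i 1)‖ ≤ L := fun i x => by
    refine ((fderiv ℝ η x).le_opNorm _).trans ?_
    rw [Pi.norm_single, norm_one, mul_one]
    exact (hL₀ x).trans (Real.le_coe_toNNReal _)
  have hK' : IsCompact (tsupport η) := hηc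
  have hη0 : ∀ x ∉ tsupport η, η x = 0 := fun x hx => image_eq_zero_of_notMem_tsupport hx
  have hη'0 : ∀ i, ∀ x ∉ tsupport η, fderiv ℝ η x (Pi.single i 1) = 0 := fun i x hx => by
    rw [image_eq_zero_of_notMem_tsupport (f := fderiv ℝ η)
      fun h => hx (tsupport_fderiv_subset ℝ h)]
    rfl
  choose V hV using fun i => exists_normLq_le_of_exponent_le hK' T (hp0 i) (hm i)
  obtain ⟨C, hC, H⟩ := exists_lintegral_criticalExponent_le hN hp hP hσ0.le
  -- The 1 accounts for `η Dᵢu`; `L * V i` accounts for `u Dᵢη`, with `V i` passing from `L^m` to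
  -- `L^{p i}` on the support of `η`.
  set c : Fin N → ℝ≥0 := fun i => 1 + L * V i with hc
  set s := criticalExponent p σ with hs
  have hs0 : 0 < s := criticalExponent_pos hN hp hσ0.le
  set D : ℝ≥0∞ := C * ∏ i, (c i : ℝ≥0∞) ^ (harmonicMean p / N) with hD
  have hDt : D ≠ ⊤ := ENNReal.mul_ne_top hC (ENNReal.prod_ne_top fun i _ =>
    ENNReal.rpow_ne_top_of_nonneg (by positivity) ENNReal.coe_ne_top)
  have hDt' : D ^ s⁻¹ ≠ ⊤ := ENNReal.rpow_ne_top_of_nonneg (by positivity) hDt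
  -- Adding 1 keeps the constant nonzero, so that the bound is trivial when the seminorm `X` is
  -- infinite.
  refine ⟨tsupport η, hK', (D ^ s⁻¹).toNNReal + 1, fun u Du hu hDu => ?_⟩
  set X := normLq m T (tsupport η) u + ∑ i, normLq (p i) T (tsupport η) (Du i) +
    normLinftyL σ T (tsupport η) u with hX
  rcases eq_or_ne X ⊤ with hXt | hXt
  · rw [hXt, ENNReal.mul_top]
    · exact le_top
    · simp
  have hXm : normLq m T (tsupport η) u ≤ X := le_self_add.trans le_self_add
  have hXD : ∀ i, normLq (p i) T (tsupport η) (Du i) ≤ X := fun i =>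
    ((Finset.single_le_sum (f := fun i => normLq (p i) T (tsupport η) (Du i))
      (fun _ _ => zero_le) (Finset.mem_univ i)).trans le_add_self).trans le_self_add
  have hXσ : normLinftyL σ T (tsupport η) u ≤ X := le_add_self
  have hgradle : ∀ i, ∫⁻ z in univ ×ˢ Ioo 0 T,
      ‖η z.1 * Du i z + fderiv ℝ η z.1 (Pi.single i 1) * u z‖ₑ ^ p i ≤ (c i * X) ^ p i := by
    intro i
    rw [lintegral_rpow_enorm_eq (hp0 i)]
    gcongr
    · exact (hp0 i).le
    refine (eLpNorm_cutoff_gradient_le hK' T (hp i) hη.continuous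
      ((hη.continuous_fderiv (by simp)).clm_apply continuous_const) hη1 hη0 (hηL i) (hη'0 i)
      hu (hDu i).1).trans ?_
    calc normLq (p i) T (tsupport η) (Du i) + L * normLq (p i) T (tsupport η) u
        ≤ X + L * (V i * X) := by
          gcongr
          · exact hXD i
          · refine (hV i u hu).trans ?_
            gcongr
      _ = c i * X := by
          simp only [hc]; push_cast; ring
  have hM : ∀ᵐ t ∂(volume.restrict (Ioo 0 T)), ∫⁻ x, ‖η x * u (x, t)‖ₑ ^ σ ≤ X ^ σ := by
    filter_upwards [ENNReal.ae_le_essSup (μ := volume.restrict (Ioo 0 T)) (fun t =>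
      eLpNorm (fun x => u (x, t)) (ENNReal.ofReal σ) (volume.restrict (tsupport η)))] with t ht
    rw [lintegral_rpow_enorm_eq hσ0]
    gcongr
    refine (eLpNorm_mul_le_of_bound (S := tsupport η) (L := 1) hK'.measurableSet
      (by simpa using hη1) hη0 _).trans ?_
    rw [ENNReal.coe_one, one_mul]
    exact ht.trans hXσ
  have main := H T (fun z => η z.1 * u z) _ (X ^ σ)
    (ENNReal.rpow_ne_top_of_nonneg hσ0.le hXt)
    ((hη.continuous.comp continuous_fst).aestronglyMeasurable.mul hu)
    (hDu.cutoff hu hη hηc) (fun t => hηc.mul_right) hM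
  -- Homogeneity: the `L^σ` factor contributes `X^(σ p̄/N)` and each of the `N` gradient factors
  -- `X^(p̄/N)`, in all `X^s`.
  have main2 : (∫⁻ z in univ ×ˢ Ioo 0 T, ‖η z.1 * u z‖ₑ ^ s) ≤ D * X ^ s := by
    refine main.trans ?_
    calc C * (X ^ σ) ^ (harmonicMean p / N) * ∏ i, (∫⁻ z in univ ×ˢ Ioo 0 T,
          ‖η z.1 * Du i z + fderiv ℝ η z.1 (Pi.single i 1) * u z‖ₑ ^ p i) ^
            (harmonicMean p / (N * p i))
        ≤ C * (X ^ σ) ^ (harmonicMean p / N) *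
            ∏ i, ((c i * X) ^ p i) ^ (harmonicMean p / (N * p i)) := by
          gcongr with i
          · have := hp0 i
            positivity
          · exact hgradle i
      _ = C * X ^ (σ * (harmonicMean p / N)) *
            ∏ i : Fin N, ((c i : ℝ≥0∞) ^ (harmonicMean p / N) * X ^ (harmonicMean p / N)) := by
          rw [← ENNReal.rpow_mul]
          congr 1
          refine Finset.prod_congr rfl fun i _ => ?_
          have := hp0 i
          rw [← ENNReal.rpow_mul, ← ENNReal.mul_rpow_of_nonneg _ _ (by positivity)]
          congr 1
          field_simp
      _ = D * (X ^ (σ * (harmonicMean p / N)) * X ^ harmonicMean p) := by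
          rw [Finset.prod_mul_distrib, prod_rpow_eq_rpow_sum _ _ fun i _ => by positivity, hD]
          have : ∑ _i : Fin N, harmonicMean p / N = harmonicMean p := by
            simp only [Finset.sum_const, Finset.card_univ, Fintype.card_fin, nsmul_eq_mul]
            field_simp
          rw [this]; ring
      _ = D * X ^ s := by
          rw [← ENNReal.rpow_add_of_nonneg _ _ (by positivity) hP0.le]
          congr 2
          rw [hs, criticalExponent]; ring
  refine (normLq_le_eLpNorm_cutoff hK s T hηK u).trans ?_
  rw [lintegral_rpow_enorm_eq hs0] at main2
  have main3 := ENNReal.rpow_le_rpow main2 (inv_nonneg.2 hs0.le)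
  rw [← ENNReal.rpow_mul, mul_inv_cancel₀ hs0.ne', ENNReal.rpow_one,
    ENNReal.mul_rpow_of_nonneg _ _ (inv_nonneg.2 hs0.le), ← ENNReal.rpow_mul,
    mul_inv_cancel₀ hs0.ne', ENNReal.rpow_one] at main3
  refine main3.trans ?_
  rw [ENNReal.coe_add, ENNReal.coe_toNNReal hDt']
  gcongr
  exact le_self_add

end AnisoParabolic

/-! ### Bootstrap of the summability exponent -/

namespace AnisoParabolic

open Filter Topology

/-- Local `L^s` control of a function by its seminorms in `L^𝐩(0, T; W^{1,𝐩}_loc)` and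
`L^∞(0, T; L^σ_loc)`. -/
def LocalControl {N : ℕ} (p : Fin N → ℝ) (σ T s : ℝ) : Prop :=
  ∀ K : Set (Fin N → ℝ), IsCompact K → ∃ K' : Set (Fin N → ℝ), IsCompact K' ∧ ∃ C : ℝ≥0,
    ∀ (u : (Fin N → ℝ) × ℝ → ℝ) (Du : Fin N → (Fin N → ℝ) × ℝ → ℝ),
      AEStronglyMeasurable u (volume.restrict (univ ×ˢ Ioo 0 T)) →
      IsSpatialGradient T u Du →
      normLq s T K u ≤ C * (normLpW1 p T K' u Du + normLinftyL σ T K' u)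

variable {N : ℕ} {p : Fin N → ℝ} {σ T s r : ℝ}

theorem LocalControl.one (p : Fin N → ℝ) (σ T : ℝ) : LocalControl p σ T 1 := by
  refine fun K hK => ⟨K, hK, 1, fun u Du _ _ => ?_⟩
  rw [ENNReal.coe_one, one_mul]
  exact le_self_add.trans le_self_add

theorem LocalControl.mono (h : LocalControl p σ T r) (hs : 0 < s) (hsr : s ≤ r) :
    LocalControl p σ T s := by
  intro K hK
  obtain ⟨K', hK', C, hC⟩ := h K hK
  obtain ⟨V, hV⟩ := exists_normLq_le_of_exponent_le hK T hs hsr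
  refine ⟨K', hK', V * C, fun u Du hu hDu => (hV u hu).trans ?_⟩
  rw [ENNReal.coe_mul, mul_assoc]
  gcongr
  exact hC u Du hu hDu

theorem harmonicMean_min_le (hN : 0 < N) (hp : ∀ i, 1 ≤ p i) (hs : 1 ≤ s) :
    harmonicMean (fun i => min (p i) s) ≤ harmonicMean p := by
  have h1 := sum_one_div_pos hN hp
  rw [harmonicMean_eq, harmonicMean_eq]
  refine div_le_div_of_nonneg_left (Nat.cast_nonneg N) h1 (Finset.sum_le_sum fun i _ => ?_)
  exact one_div_le_one_div_of_le (lt_min (by linarith [hp i]) (by linarith)) (min_le_left _ _)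

/-- Termwise, `s / min (p i) s ≤ m / p i`: if `p i ≤ s` this is `s ≤ m`, otherwise the left side is
1 and `p i ≤ m`. Summing shows that truncation at `s` shrinks the harmonic mean by a factor no
smaller than `s / m`. -/
theorem mul_le_criticalExponent_min (hN : 0 < N) (hp : ∀ i, 1 ≤ p i) (hσ : 0 ≤ σ) {m : ℝ}
    (hm : ∀ i, p i ≤ m) (hs : 1 ≤ s) (hsm : s ≤ m) :
    criticalExponent p σ / m * s ≤ criticalExponent (fun i => min (p i) s) σ := by
  have hp0 : ∀ i, 0 < p i := fun i => zero_lt_one.trans_le (hp i)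
  have hs0 : 0 < s := by linarith
  have hm0 : 0 < m := by linarith
  have hmin : ∀ i, 1 ≤ min (p i) s := fun i => le_min (hp i) hs
  have h1 := sum_one_div_pos hN hp
  have h2 := sum_one_div_pos hN hmin
  have key : s * ∑ i, 1 / min (p i) s ≤ m * ∑ i, 1 / p i := by
    rw [Finset.mul_sum, Finset.mul_sum]
    refine Finset.sum_le_sum fun i _ => ?_
    rw [mul_one_div, mul_one_div]
    rcases le_total (p i) s with h | h
    · rw [min_eq_left h]
      exact div_le_div_of_nonneg_right hsm (hp0 i).le
    · rw [min_eq_right h, div_self hs0.ne', one_le_div (hp0 i)]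
      exact hm i
  have hmean : harmonicMean p / m * s ≤ harmonicMean fun i => min (p i) s := by
    rw [harmonicMean_eq, harmonicMean_eq, le_div_iff₀ h2, div_div, div_mul_eq_mul_div,
      div_mul_eq_mul_div, div_le_iff₀ (by positivity)]
    calc (N : ℝ) * s * ∑ i, 1 / min (p i) s = N * (s * ∑ i, 1 / min (p i) s) := by ring
      _ ≤ N * (m * ∑ i, 1 / p i) := by gcongr
      _ = N * ((∑ i, 1 / p i) * m) := by ring
  rw [criticalExponent, criticalExponent]
  calc harmonicMean p * (1 + σ / N) / m * s = harmonicMean p / m * s * (1 + σ / N) := by ring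
    _ ≤ _ := by gcongr

/-- One bootstrap step: for the truncated exponents, `L^s` control suffices for the cutoff terms,
and the derivatives lose only local integrability. Truncation lowers the harmonic mean, so it stays
below `N`. -/
theorem LocalControl.criticalExponent_min (hN : 0 < N) (hp : ∀ i, 1 ≤ p i)
    (hP : harmonicMean p < N) (hσ : 1 ≤ σ) (hs : 1 ≤ s) (h : LocalControl p σ T s) :
    LocalControl p σ T (criticalExponent (fun i => min (p i) s) σ) := by
  have hmin : ∀ i, 1 ≤ min (p i) s := fun i => le_min (hp i) hs
  intro K hK
  obtain ⟨K₁, hK₁, C₁, h₁⟩ := exists_normLq_criticalExponent_le hN hmin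
    ((harmonicMean_min_le hN hp hs).trans_lt hP) hσ (m := s) (fun i => min_le_right _ _) T hK
  obtain ⟨K₂, hK₂, C₂, h₂⟩ := h K₁ hK₁
  choose V hV using fun i => exists_normLq_le_of_exponent_le hK₁ T
    (zero_lt_one.trans_le (hmin i)) (min_le_left (p i) s)
  have hK1 : K₁ ⊆ K₁ ∪ K₂ := subset_union_left
  have hK2 : K₂ ⊆ K₁ ∪ K₂ := subset_union_right
  refine ⟨K₁ ∪ K₂, hK₁.union hK₂, C₁ * (C₂ + ∑ i, V i + 1), fun u Du hu hDu => ?_⟩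
  set X := normLpW1 p T (K₁ ∪ K₂) u Du + normLinftyL σ T (K₁ ∪ K₂) u with hX
  refine (h₁ u Du hu hDu).trans ?_
  push_cast
  rw [mul_assoc, add_mul, add_mul, one_mul, Finset.sum_mul]
  gcongr with i
  · refine (h₂ u Du hu hDu).trans ?_
    gcongr
    exact add_le_add (normLpW1_mono hK2 _ _ _) (normLinftyL_mono hK2 _ _)
  · refine (hV i _ (hDu i).1).trans ?_
    gcongr
    refine (normLq_mono hK1 _ _).trans (le_trans ?_ (le_self_add : normLpW1 p T _ u Du ≤ X))
    exact (Finset.single_le_sum (f := fun i => normLq (p i) T (K₁ ∪ K₂) (Du i))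
      (fun _ _ => zero_le) (Finset.mem_univ i)).trans le_add_self
  · exact (normLinftyL_mono hK1 _ _).trans le_add_self

/-- The local parabolic embedding without `L^{p_N}` control, by iterating the embedding for the
exponents `min pᵢ s`: each step improves `L^s` to `L^{κ s}` with `κ = p̄_σ / p_N > 1`. -/
theorem localControl_criticalExponent (hN : 0 < N) (hp : ∀ i, 1 ≤ p i)
    (hP : harmonicMean p < N) (hσ : 1 ≤ σ) {m : ℝ} (hm : ∀ i, p i ≤ m)
    (hcrit : m < criticalExponent p σ) : LocalControl p σ T (criticalExponent p σ) := by
  have hm1 : 1 ≤ m := (hp ⟨0, hN⟩).trans (hm _)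
  have hm0 : 0 < m := by linarith
  set κ := criticalExponent p σ / m with hκ
  have hκ1 : 1 < κ := by rw [hκ, one_lt_div hm0]; exact hcrit
  -- The cap at `m` keeps `s ≤ m`, which the gain by the factor `κ` requires; the start `κ ^ 0 = 1`
  -- is the `L¹` seminorm.
  have step : ∀ n : ℕ, LocalControl p σ T (min (κ ^ n) m) := by
    intro n
    induction n with
    | zero => rw [pow_zero, min_eq_left hm1]; exact LocalControl.one p σ T
    | succ n ih =>
      have hs1 : 1 ≤ min (κ ^ n) m := le_min (one_le_pow₀ hκ1.le) hm1
      have hκs := mul_le_criticalExponent_min hN hp (by linarith : 0 ≤ σ) hm hs1 (min_le_right _ _)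
      refine (ih.criticalExponent_min hN hp hP hσ hs1).mono (lt_min (by positivity) hm0)
        (le_trans ?_ hκs)
      rw [← hκ, mul_min_of_nonneg _ _ (by linarith), ← pow_succ']
      exact min_le_min le_rfl (le_mul_of_one_le_left hm0.le hκ1.le)
  obtain ⟨n, hn⟩ := pow_unbounded_of_one_lt m hκ1
  have h := step n
  rw [min_eq_right hn.le] at h
  -- At `s = m` truncation changes nothing, so one more step gives the full critical exponent.
  have h' := h.criticalExponent_min hN hp hP hσ hm1
  simpa only [min_eq_left (hm _)] using h'

theorem mem_LqLoc_of_normLq_ne_top {q : ℝ} {u : (Fin N → ℝ) × ℝ → ℝ}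
    (hu : AEStronglyMeasurable u (volume.restrict (univ ×ˢ Ioo 0 T)))
    (h : ∀ K : Set (Fin N → ℝ), IsCompact K → normLq q T K u ≠ ⊤) : u ∈ LqLoc N q T :=
  fun K hK => ⟨hu.mono_measure (Measure.restrict_mono (prod_mono (subset_univ K) le_rfl) le_rfl),
    (h K hK).lt_top⟩

theorem normLpW1_ne_top {u : (Fin N → ℝ) × ℝ → ℝ} {Du : Fin N → (Fin N → ℝ) × ℝ → ℝ}
    (hu : u ∈ LqLoc N 1 T) (hDu : ∀ i, Du i ∈ LqLoc N (p i) T) {K : Set (Fin N → ℝ)}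
    (hK : IsCompact K) : normLpW1 p T K u Du ≠ ⊤ :=
  ENNReal.add_ne_top.2 ⟨(hu K hK).2.ne, ENNReal.sum_ne_top.2 fun i _ => (hDu i K hK).2.ne⟩

end AnisoParabolic

/-! ### The two embeddings -/

theorem mainTheorem6 {N : ℕ} (hN : 0 < N) (p : Fin N → ℝ) (σ T : ℝ) (hT : 0 < T)
    (hp_one : ∀ i, 1 ≤ p i) (hp_mono : Monotone p)
    (hp_bar : AnisoParabolic.harmonicMean p < N)
    (hσ_one : 1 ≤ σ) (hσ_le : σ ≤ AnisoParabolic.sobolevExponent p) :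
    -- first embedding: inclusion and continuity
    ((AnisoParabolic.LqLoc N (p ⟨N - 1, Nat.sub_lt hN one_pos⟩) T ∩
          AnisoParabolic.LpW1Loc p T ∩ AnisoParabolic.LinftyLoc N σ T ⊆
        AnisoParabolic.LqLoc N (AnisoParabolic.criticalExponent p σ) T) ∧
      (∀ K : Set (Fin N → ℝ), IsCompact K →
        ∃ K' : Set (Fin N → ℝ), IsCompact K' ∧ ∃ C : ℝ≥0,
          ∀ (u : (Fin N → ℝ) × ℝ → ℝ) (Du : Fin N → (Fin N → ℝ) × ℝ → ℝ),
            u ∈ AnisoParabolic.LqLoc N (p ⟨N - 1, Nat.sub_lt hN one_pos⟩) T ∩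
              AnisoParabolic.LpW1Loc p T ∩ AnisoParabolic.LinftyLoc N σ T →
            AnisoParabolic.IsSpatialGradient T u Du →
            AnisoParabolic.normLq (AnisoParabolic.criticalExponent p σ) T K u ≤
              C * (AnisoParabolic.normLq (p ⟨N - 1, Nat.sub_lt hN one_pos⟩) T K' u +
                AnisoParabolic.normLpW1 p T K' u Du +
                AnisoParabolic.normLinftyL σ T K' u))) ∧
    -- second embedding: inclusion and continuity, without a priori `L^{p_N}` summability
    (p ⟨N - 1, Nat.sub_lt hN one_pos⟩ < AnisoParabolic.criticalExponent p σ →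
      (AnisoParabolic.LpW1Loc p T ∩ AnisoParabolic.LinftyLoc N σ T ⊆
        AnisoParabolic.LqLoc N (AnisoParabolic.criticalExponent p σ) T) ∧
      (∀ K : Set (Fin N → ℝ), IsCompact K →
        ∃ K' : Set (Fin N → ℝ), IsCompact K' ∧ ∃ C : ℝ≥0,
          ∀ (u : (Fin N → ℝ) × ℝ → ℝ) (Du : Fin N → (Fin N → ℝ) × ℝ → ℝ),
            u ∈ AnisoParabolic.LpW1Loc p T ∩ AnisoParabolic.LinftyLoc N σ T →
            AnisoParabolic.IsSpatialGradient T u Du →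
            AnisoParabolic.normLq (AnisoParabolic.criticalExponent p σ) T K u ≤
              C * (AnisoParabolic.normLpW1 p T K' u Du +
                AnisoParabolic.normLinftyL σ T K' u))) := by
  -- Monotonicity makes the last exponent, at index `N - 1`, the largest, hence a valid `m`.
  have hm : ∀ i, p i ≤ p ⟨N - 1, Nat.sub_lt hN one_pos⟩ := fun i =>
    hp_mono (Fin.le_def.2 (Nat.le_sub_one_of_lt i.2))
  have hA : ∀ K : Set (Fin N → ℝ), IsCompact K → ∃ K' : Set (Fin N → ℝ), IsCompact K' ∧
      ∃ C : ℝ≥0, ∀ (u : (Fin N → ℝ) × ℝ → ℝ) (Du : Fin N → (Fin N → ℝ) × ℝ → ℝ),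
        AEStronglyMeasurable u (volume.restrict (univ ×ˢ Ioo 0 T)) →
        AnisoParabolic.IsSpatialGradient T u Du →
        AnisoParabolic.normLq (AnisoParabolic.criticalExponent p σ) T K u ≤
          C * (AnisoParabolic.normLq (p ⟨N - 1, Nat.sub_lt hN one_pos⟩) T K' u +
            AnisoParabolic.normLpW1 p T K' u Du + AnisoParabolic.normLinftyL σ T K' u) := by
    intro K hK
    obtain ⟨K', hK', C, h⟩ :=
      AnisoParabolic.exists_normLq_criticalExponent_le hN hp_one hp_bar hσ_one hm T hK
    refine ⟨K', hK', C, fun u Du hu hDu => (h u Du hu hDu).trans ?_⟩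
    gcongr
    exact le_add_self
  refine ⟨⟨?_, ?_⟩, fun hcrit => ⟨?_, ?_⟩⟩
  · rintro u ⟨⟨hum, hu1, Du, hDu, hDup⟩, hum', huσ⟩
    refine AnisoParabolic.mem_LqLoc_of_normLq_ne_top hum' fun K hK => ?_
    obtain ⟨K', hK', C, h⟩ := hA K hK
    refine ne_top_of_le_ne_top (ENNReal.mul_ne_top ENNReal.coe_ne_top ?_) (h u Du hum' hDu)
    exact ENNReal.add_ne_top.2 ⟨ENNReal.add_ne_top.2 ⟨(hum K' hK').2.ne,
      AnisoParabolic.normLpW1_ne_top hu1 hDup hK'⟩, (huσ K' hK').ne⟩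
  · intro K hK
    obtain ⟨K', hK', C, h⟩ := hA K hK
    exact ⟨K', hK', C, fun u Du hu hDu => h u Du hu.2.1 hDu⟩
  · have hB := AnisoParabolic.localControl_criticalExponent (T := T) hN hp_one hp_bar hσ_one hm
      hcrit
    rintro u ⟨⟨hu1, Du, hDu, hDup⟩, hum', huσ⟩
    refine AnisoParabolic.mem_LqLoc_of_normLq_ne_top hum' fun K hK => ?_
    obtain ⟨K', hK', C, h⟩ := hB K hK
    refine ne_top_of_le_ne_top (ENNReal.mul_ne_top ENNReal.coe_ne_top ?_) (h u Du hum' hDu)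
    exact ENNReal.add_ne_top.2 ⟨AnisoParabolic.normLpW1_ne_top hu1 hDup hK', (huσ K' hK').ne⟩
  · have hB := AnisoParabolic.localControl_criticalExponent (T := T) hN hp_one hp_bar hσ_one hm
      hcrit
    intro K hK
    obtain ⟨K', hK', C, h⟩ := hB K hK
    exact ⟨K', hK', C, fun u Du hu hDu => h u Du hu.2.1 hDu⟩
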